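/- **Definitions.** Let $\mathbb F$ be a finite field and $I$ a finite index set. A linear code over $\mathbb F$ on $I$ is a subspace $\mathcal C\subseteq\mathbb F^I$; it is an $[n,k,d]$ code if $|I|=n$, $\dim\mathcal C=k$, and its minimum Hamming distance is $d$. Let $G=(V,E)$ be a finite graph (here a tree) and $\omega:I\to V$ a map; write $E(v)$ for the set of edges incident with $v$. A *graphical model* extending $(G,\omega)$ consists of a finite-dimensional $\mathbb F$-vector space $S_e$ for each $e\in E$ and a subspace $C_v\subseteq\mathbb F^{\omega^{-1}(v)}\oplus\bigoplus_{e\in E(v)}S_e$ for each $v\in V$. Its *full behavior* $\mathfrak B$ is the set of all $((x_i)_{i\in I},(s_e)_{e\in E})\in\mathbb F^I\oplus\bigoplus_{e\in E}S_e$ with $((x_i)_{i\in\omega^{-1}(v)},(s_e)_{e\in E(v)})\in C_v$ for every $v\in V$. The model is a *realization* of $\mathcal C$ on $G$ if $\mathfrak B$ projects onto every $C_v$ and onto every $S_e$, and the projection of $\mathfrak B$ to $\mathbb F^I$ equals $\mathcal C$. Its *$\kappa$-complexity* is $\max_{v\in V}\dim C_v$. The *treewidth* $\kappa_{\mathrm{tree}}(\mathcal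 C)$ is the least $\kappa$-complexity of a realization of $\mathcal C$ on a finite tree (over all trees and all maps $\omega$), and the *pathwidth* (or *trellis-width*) $\kappa_{\mathrm{path}}(\mathcal C)$ is the least $\kappa$-complexity of a realization of $\mathcal C$ on a path (a tree with exactly two leaves). **Proposition.** (a) For every $[n,k,d]$ linear code $\mathcal C$ over a finite field with $n>1$, $$\kappa_{\mathrm{tree}}(\mathcal C)\ \ge\ \frac{\kappa_{\mathrm{path}}(\mathcal C)}{3+2\log_2(n-1)}\ \ge\ \frac{k(d-1)}{n\,(3+2\log_2(n-1))}.$$ (For the zero code the convention is $d=0$.) (b) Consequently, the ratio of trellis-width to treewidth is $O(\log n)$: there is an absolute constant $c>0$ such that for every finite field and every nonzero linear code $\mathcal C$ of length $n>1$ over it, $\kappa_{\mathrm{tree}}(\mathcal C)>0$ and $$\frac{\kappa_{\mathrm{path}}(\mathcal C)}{\kappa_{\mathrm{tree}}(\mathcal C)}\ \le\ c\,\log_2 n.$$ -/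

import Mathlib

universe u v

section LinearCodes

variable {F : Type u} [Field F] {I : Type v} [Fintype I]

open Classical in
/-- The minimum distance of a linear code: the least Hamming distance between two distinct
codewords. (For the zero code, which has no two distinct codewords, this is `0`.) -/
noncomputable def minDist (C : Submodule F (I → F)) : ℕ :=
  sInf {r : ℕ | ∃ x ∈ C, ∃ y ∈ C, x ≠ y ∧ r = hammingDist x y}

/-- `C` is an `[n, k, d]` linear code: length `n`, dimension `k`, minimum distance `d`. -/
def IsLinearCodeWith (C : Submodule F (I → F)) (n k d : ℕ) : Prop :=
  Fintype.card I = n ∧ Module.finrank F C = k ∧ minDist C = d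

end LinearCodes

/-- A graphical model `(G, ω, (S_e), (C_v))` over the field `F` that extends the graph decomposition
`(G, ω)` of the index set `I`: a finite-dimensional state space `S e` for each edge `e`, and for each
vertex `v` a local constraint code `C v`, which is a subspace of the direct sum of `F^{ω⁻¹(v)}` and of
the state spaces of the edges incident with `v`. -/
structure GraphicalModel (F : Type u) [Field F] {I : Type v} {V : Type} (G : SimpleGraph V)
    (ω : I → V) where
  /-- the state spaces -/
  S : G.edgeSet → Type (max u v)
  [addCommGroup : ∀ e, AddCommGroup (S e)]
  [module : ∀ e, Module F (S e)]
  [finiteDimensional : ∀ e, FiniteDimensional F (S e)]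
  /-- the local constraint codes -/
  C : ∀ w : V, Submodule F
    (({i : I // ω i = w} → F) × (∀ e : {e : G.edgeSet // w ∈ (e : Sym2 V)}, S e.1))

namespace GraphicalModel

attribute [instance] GraphicalModel.addCommGroup GraphicalModel.module
  GraphicalModel.finiteDimensional

variable {F : Type u} [Field F] {I : Type v} {V : Type} {G : SimpleGraph V} {ω : I → V}

/-- Global configurations: an assignment of values to all symbol and state variables. -/
abbrev Config (Γ : GraphicalModel F G ω) : Type (max u v) :=
  (I → F) × (∀ e : G.edgeSet, Γ.S e)

/-- Local configurations at the vertex `w`. -/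
abbrev LocalConfig (Γ : GraphicalModel F G ω) (w : V) : Type (max u v) :=
  ({i : I // ω i = w} → F) × (∀ e : {e : G.edgeSet // w ∈ (e : Sym2 V)}, Γ.S e.1)

/-- The map that sends a global configuration to its local configuration at the vertex `w`. -/
def toLocal (Γ : GraphicalModel F G ω) (w : V) : Γ.Config →ₗ[F] Γ.LocalConfig w where
  toFun b := (fun i => b.1 i.1, fun e => b.2 e.1)
  map_add' _ _ := rfl
  map_smul' _ _ := rfl

/-- The map that sends a global configuration to its state at the edge `e`. -/
def toState (Γ : GraphicalModel F G ω) (e : G.edgeSet) : Γ.Config →ₗ[F] Γ.S e where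
  toFun b := b.2 e
  map_add' _ _ := rfl
  map_smul' _ _ := rfl

/-- The map that sends a global configuration to its symbol variables. -/
def toSymbols (Γ : GraphicalModel F G ω) : Γ.Config →ₗ[F] (I → F) where
  toFun b := b.1
  map_add' _ _ := rfl
  map_smul' _ _ := rfl

/-- The full behavior: the global configurations that satisfy all local constraints. -/
def behavior (Γ : GraphicalModel F G ω) : Submodule F Γ.Config :=
  ⨅ w : V, (Γ.C w).comap (Γ.toLocal w)

/-- The model is essential: the full behavior projects onto each local constraint code and onto
each state space. -/
def Essential (Γ : GraphicalModel F G ω) : Prop :=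
  (∀ w : V, Γ.behavior.map (Γ.toLocal w) = Γ.C w) ∧
    ∀ e : G.edgeSet, Γ.behavior.map (Γ.toState e) = ⊤

/-- The model is a graphical realization of the code `C`: it is essential, and its full behavior
projects onto `C` in the symbol variables. -/
def Realizes (Γ : GraphicalModel F G ω) (C : Submodule F (I → F)) : Prop :=
  Γ.Essential ∧ Γ.behavior.map Γ.toSymbols = C

/-- The `κ`-complexity of a model: the maximum of the dimensions of its local constraint codes. -/
noncomputable def kappa [Fintype V] (Γ : GraphicalModel F G ω) : ℕ :=
  Finset.univ.sup fun w : V => Module.finrank F (Γ.C w)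

end GraphicalModel

section Widths

variable {F : Type u} [Field F] {I : Type v}

/-- `κ(C; G, ω)`: the least `κ`-complexity of a realization of `C` that extends `(G, ω)`. -/
noncomputable def kappaDecomposition (C : Submodule F (I → F)) {V : Type} [Fintype V]
    (G : SimpleGraph V) (ω : I → V) : ℕ :=
  sInf {r : ℕ | ∃ Γ : GraphicalModel F G ω, Γ.Realizes C ∧ r = Γ.kappa}

/-- `κ(C; G)`, the `G`-width of `C`: the minimum of `κ(C; G, ω)` over all index mappings `ω`. -/
noncomputable def kappaGraph (C : Submodule F (I → F)) {V : Type} [Fintype V]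
    (G : SimpleGraph V) : ℕ :=
  sInf {r : ℕ | ∃ ω : I → V, r = kappaDecomposition C G ω}

/-- The minimum of `κ(C; G)` over all finite graphs `G` in a given family of graphs. -/
noncomputable def kappaFamily (C : Submodule F (I → F))
    (family : ∀ V : Type, SimpleGraph V → Prop) : ℕ :=
  sInf {r : ℕ | ∃ (V : Type) (_ : Fintype V) (G : SimpleGraph V),
    family V G ∧ r = kappaGraph C G}

/-- A path: a graph isomorphic to `0 — 1 — ⋯ — m + 1` for some `m : ℕ`
(so a path has two distinct end-points). -/
def IsPathGraph {V : Type} (G : SimpleGraph V) : Prop :=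
  ∃ m : ℕ, Nonempty (G ≃g SimpleGraph.pathGraph (m + 2))

/-- The treewidth of a code: the least `κ`-complexity of a realization on a tree. -/
noncomputable def codeTreewidth (C : Submodule F (I → F)) : ℕ :=
  kappaFamily C fun _ G => G.IsTree

/-- The pathwidth (trellis-width) of a code: the least `κ`-complexity of a realization on a path. -/
noncomputable def codePathwidth (C : Submodule F (I → F)) : ℕ :=
  kappaFamily C fun _ G => IsPathGraph G

end Widths

section Existence

variable {F : Type u} [Field F] {I : Type v} {V : Type}

/-- The map `c ↦ (c, (c)_e)` whose local configurations define a trivial realization of `C`. -/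
def diagLocal (C : Submodule F (I → F)) (G : SimpleGraph V) (ω : I → V) (w : V) :
    C →ₗ[F] ({i : I // ω i = w} → F) × ({e : G.edgeSet // w ∈ (e : Sym2 V)} → C) where
  toFun c := (fun i => c.1 i.1, fun _ => c)
  map_add' _ _ := rfl
  map_smul' _ _ := rfl

/-- The trivial model: every state space is `C`, and all states are forced to agree. -/
def diagModel [Finite I] (C : Submodule F (I → F)) (G : SimpleGraph V) (ω : I → V) :
    GraphicalModel F G ω where
  S _ := C
  C w := LinearMap.range (diagLocal C G ω w)

/-- Every graph decomposition with a connected graph extends to a realization of the code, so the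
minimum in `kappaDecomposition` is taken over a nonempty set. -/
theorem exists_realizes [Finite I] (C : Submodule F (I → F)) (G : SimpleGraph V)
    (hG : G.Connected) (ω : I → V) : ∃ Γ : GraphicalModel F G ω, Γ.Realizes C := by
  have key : ∀ b : (diagModel C G ω).Config, b ∈ (diagModel C G ω).behavior ↔
      ∃ c : C, b = ((c : I → F), fun _ => c) := by
    intro b
    simp only [GraphicalModel.behavior, Submodule.mem_iInf, Submodule.mem_comap]
    constructor
    · intro h
      choose c hc using h
      have h1 : ∀ (i : I), (c (ω i) : I → F) i = b.1 i := fun i =>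
        congrFun (congrArg Prod.fst (hc (ω i))) ⟨i, rfl⟩
      have h2 : ∀ (w : V) (e : G.edgeSet), w ∈ (e : Sym2 V) → c w = b.2 e := fun w e he =>
        congrFun (congrArg Prod.snd (hc w)) ⟨e, he⟩
      have hadj : ∀ x y, G.Adj x y → c x = c y := fun x y hxy =>
        (h2 x ⟨s(x, y), hxy⟩ (Sym2.mem_mk_left x y)).trans
          (h2 y ⟨s(x, y), hxy⟩ (Sym2.mem_mk_right x y)).symm
      have hall : ∀ x y, c x = c y := by
        intro x y
        obtain ⟨p⟩ := hG.preconnected x y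
        induction p with
        | nil => rfl
        | cons h _ ih => exact (hadj _ _ h).trans ih
      obtain ⟨w0⟩ := hG.nonempty
      refine ⟨c w0, Prod.ext ?_ ?_⟩
      · funext i
        rw [← h1 i, hall (ω i) w0]
      · funext e
        obtain ⟨e, he⟩ := e
        induction e with
        | _ x y => exact (h2 x ⟨s(x, y), he⟩ (Sym2.mem_mk_left x y)).symm.trans (hall _ _)
    · rintro ⟨c, rfl⟩ w
      exact ⟨c, rfl⟩
  refine ⟨diagModel C G ω, ⟨?_, ?_⟩, ?_⟩
  · intro w
    ext z
    constructor
    · rintro ⟨b, hb, rfl⟩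
      obtain ⟨c, rfl⟩ := (key b).1 hb
      exact ⟨c, rfl⟩
    · rintro ⟨c, rfl⟩
      exact ⟨_, (key _).2 ⟨c, rfl⟩, rfl⟩
  · intro e
    refine eq_top_iff.2 fun s _ => ?_
    exact ⟨((show C from s : C), fun _ => s), (key _).2 ⟨s, rfl⟩, rfl⟩
  · ext x
    constructor
    · rintro ⟨b, hb, rfl⟩
      obtain ⟨c, rfl⟩ := (key b).1 hb
      exact c.2
    · intro hx
      exact ⟨((⟨x, hx⟩ : C).1, fun _ => (⟨x, hx⟩ : C)), (key _).2 ⟨⟨x, hx⟩, rfl⟩, rfl⟩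

end Existence

/-! Both widths are compared with linear orders of the index set. For an order and an index `i`,
call two codewords supported strictly before and strictly after `i` a split; the cost at `i` is the
dimension of `C` minus that of the sums of splits. An order whose costs are all at most `K` gives a
path realization of complexity at most `K` (`codePathwidth_le`): the state at an edge is the class
of a codeword modulo those that split there. Conversely, in any realization, a vertex set `W` that
separates the earlier indices from the later ones and holds `i` bounds the cost by `W.card * κ`
(`GraphicalModel.Realizes.finrank_le`). On a tree, removing centroids recursively produces an order
with separators of at most `⌊log₂ n⌋ + 1` vertices (`SimpleGraph.IsAcyclic.exists_order`), so the
pathwidth is at most `(⌊log₂ n⌋ + 1)` times the treewidth. On a path one vertex separates, so the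
costs are at most the pathwidth, and a telescoping sum over the order gives `k * d ≤ n * pathwidth`
(`finrank_mul_minDist_le`). Both bounds are stronger than the stated ones. Positivity in (b)
follows: treewidth zero would force `k * d = 0`. -/

/-! ### Separators in forests: centroids and an order with logarithmic separators. -/

section Linked

variable {V : Type*} {G : SimpleGraph V}

/-- `x` and `y` are joined by a walk of `G` that avoids the set `U` of vertices. -/
def Linked (G : SimpleGraph V) (U : Set V) (x y : V) : Prop :=
  x ∉ U ∧ Relation.ReflTransGen (fun a b => G.Adj a b ∧ b ∉ U) x y

namespace Linked

variable {U U' : Set V} {x y z : V}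

theorem refl (h : x ∉ U) : Linked G U x x := ⟨h, .refl⟩

theorem left (h : Linked G U x y) : x ∉ U := h.1

theorem right (h : Linked G U x y) : y ∉ U := by
  obtain ⟨h1, h2⟩ := h
  induction h2 with
  | refl => exact h1
  | tail _ h _ => exact h.2

theorem trans (h : Linked G U x y) (h' : Linked G U y z) : Linked G U x z := ⟨h.1, h.2.trans h'.2⟩

theorem tail (h : Linked G U x y) (h' : G.Adj y z) (hz : z ∉ U) : Linked G U x z :=
  ⟨h.1, h.2.tail ⟨h', hz⟩⟩

theorem symm (h : Linked G U x y) : Linked G U y x := by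
  obtain ⟨h1, h2⟩ := h
  induction h2 with
  | refl => exact refl h1
  | tail hp h ih =>
    exact ((refl h.2).tail h.1.symm (right ⟨h1, hp⟩)).trans ih

/-- To change the avoided set, it suffices that the vertices linked to `x` avoid the new set. -/
theorem imp (h : Linked G U x y) (hU : ∀ z, Linked G U x z → z ∉ U') : Linked G U' x y := by
  obtain ⟨h1, h2⟩ := h
  induction h2 with
  | refl => exact refl (hU _ (refl h1))
  | tail hp h ih => exact ih.tail h.1 (hU _ (tail ⟨h1, hp⟩ h.1 h.2))

theorem anti (hU : U' ⊆ U) (h : Linked G U x y) : Linked G U' x y :=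
  h.imp fun _ hz hz' => hz.right (hU hz')

theorem setOf_eq (h : Linked G U x y) : {z | Linked G U x z} = {z | Linked G U y z} :=
  Set.ext fun _ => ⟨h.symm.trans, h.trans⟩

theorem reachable {H : SimpleGraph V} (h : Linked G U x y)
    (hH : ∀ a b, G.Adj a b → a ∉ U → b ∉ U → H.Adj a b) : H.Reachable x y := by
  obtain ⟨h1, h2⟩ := h
  induction h2 with
  | refl => exact .refl _
  | tail hp h ih => exact ih.trans (hH _ _ h.1 (right ⟨h1, hp⟩) h.2).reachable

/-- Either a walk avoids `v`, or it reaches a neighbour of `v` before it meets `v`. -/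
theorem avoid_or_adj (h : Linked G U x y) (v : V) (hx : x ≠ v) :
    Linked G (insert v U) x y ∨ ∃ u, Linked G (insert v U) x u ∧ G.Adj u v := by
  obtain ⟨h1, h2⟩ := h
  induction h2 with
  | refl => exact .inl (refl (by simp [hx, h1]))
  | @tail b c hp h ih =>
    rcases ih with ih | ih
    · by_cases hc : c = v
      · exact .inr ⟨b, ih, hc ▸ h.1⟩
      · exact .inl (ih.tail h.1 (by simp [hc, h.2]))
    · exact .inr ih

end Linked

/-- In a graph without cycles, the two sides of an edge are disjoint. -/
theorem SimpleGraph.IsAcyclic.not_linked_both (hG : G.IsAcyclic) {U : Set V} {p q z : V}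
    (h : G.Adj p q) (h1 : Linked G (insert p U) q z) (h2 : Linked G (insert q U) p z) : False := by
  have hb := SimpleGraph.isAcyclic_iff_forall_isBridge.1 hG (e := s(p, q)) h
  -- The edge `pq` is a bridge, but each of the two walks avoids one of its ends, so together they
  -- would join `p` to `q` without using it.
  rw [SimpleGraph.isBridge_iff] at hb
  refine hb ?_
  refine (h2.reachable ?_).trans (h1.reachable ?_).symm
  · intro a b hab ha hb
    simp only [Set.mem_insert_iff, not_or] at ha hb
    simp [SimpleGraph.deleteEdges_adj, hab, ha.1, hb.1]
  · intro a b hab ha hb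
    simp only [Set.mem_insert_iff, not_or] at ha hb
    simp [SimpleGraph.deleteEdges_adj, hab, ha.1, hb.1]

/-- The component of `x` in a forest with `U` removed has a vertex whose removal leaves
components that carry at most half of the weight. -/
theorem SimpleGraph.IsAcyclic.exists_centroid [Finite V] (hG : G.IsAcyclic) {I : Type*} [Finite I]
    (ω : I → V) (U : Set V) (N : ℕ) {x : V} (hx : x ∉ U)
    (hN : {i | Linked G U x (ω i)}.ncard < 2 * N) :
    ∃ v, Linked G U x v ∧
      ∀ y, Linked G U x y → {i | Linked G (insert v U) y (ω i)}.ncard < N := by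
  -- Otherwise every `v` in the component leaves a heavy piece, of weight at least `N`. A pair `(v,
  -- y)` whose heavy piece has fewest vertices is taken, and `v` is moved to its neighbour `p` in
  -- that piece.
  by_contra! hcon
  have hex : ∃ m v y, Linked G U x v ∧ Linked G U x y ∧
      N ≤ {i | Linked G (insert v U) y (ω i)}.ncard ∧
      {z | Linked G (insert v U) y z}.ncard = m := by
    obtain ⟨y, hy, hy'⟩ := hcon x (.refl hx)
    exact ⟨_, x, y, .refl hx, hy, hy', rfl⟩
  have hNpos : 0 < N := by omega
  have hne : ∀ {v y}, N ≤ {i | Linked G (insert v U) y (ω i)}.ncard → y ≠ v := by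
    rintro v y h rfl
    have h0 : {i | Linked G (insert y U) y (ω i)} = ∅ :=
      Set.eq_empty_of_forall_notMem fun i hi => hi.left (Set.mem_insert _ _)
    rw [h0, Set.ncard_empty] at h
    omega
  classical
  obtain ⟨v, y, hv, hy, hyN, hm⟩ := Nat.find_spec hex
  have hmin : ∀ v' y', Linked G U x v' → Linked G U x y' →
      N ≤ {i | Linked G (insert v' U) y' (ω i)}.ncard →
      {z | Linked G (insert v U) y z}.ncard ≤ {z | Linked G (insert v' U) y' z}.ncard :=
    fun v' y' h1 h2 h3 => hm ▸ Nat.find_min' hex ⟨v', y', h1, h2, h3, rfl⟩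
  have hadj : ∀ {v y}, Linked G U x v → Linked G U x y → y ≠ v →
      ∃ u, Linked G (insert v U) y u ∧ G.Adj u v := by
    intro v y hv hy hyv
    rcases (hy.symm.trans hv).avoid_or_adj v hyv with h | h
    · exact absurd (Set.mem_insert _ _) h.right
    · exact h
  obtain ⟨p, hyp, hpv⟩ := hadj hv hy (hne hyN)
  have hp : Linked G U x p := hy.trans (hyp.anti (Set.subset_insert _ _))
  obtain ⟨y', hy', hyN'⟩ := hcon p hp
  -- If the heavy piece at `p` contains `v`, the two heavy pieces lie on opposite sides of the edge
  -- `pv`, so the total weight is at least `2 * N`. If not, it lies inside the old piece and misses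
  -- `p`, against minimality.
  by_cases hvy : Linked G (insert p U) y' v
  · have hsub : {i | Linked G (insert v U) y (ω i)} ∪ {i | Linked G (insert p U) y' (ω i)} ⊆
        {i | Linked G U x (ω i)} := by
      rintro i (hi | hi)
      · exact hy.trans (hi.anti (Set.subset_insert _ _))
      · exact hy'.trans (hi.anti (Set.subset_insert _ _))
    have hdisj : Disjoint {i | Linked G (insert v U) y (ω i)}
        {i | Linked G (insert p U) y' (ω i)} :=
      Set.disjoint_left.2 fun i hi hi' =>
        hG.not_linked_both hpv (hvy.symm.trans hi') (hyp.symm.trans hi)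
    have h1 := Set.ncard_union_eq hdisj
    have h2 := Set.ncard_le_ncard hsub
    omega
  · obtain ⟨q, hq, hqp⟩ := hadj hp hy' (hne hyN')
    have key : ∀ z, Linked G (insert p U) y' z → Linked G (insert v U) y z := by
      have h1 : ∀ z, Linked G (insert p U) y' z → Linked G (insert v U) y' z := fun z hz =>
        hz.imp fun t ht => by
          have := ht.right
          simp only [Set.mem_insert_iff, not_or] at this ⊢
          exact ⟨fun h => hvy (h ▸ ht), this.2⟩
      intro z hz
      have h2 : Linked G (insert v U) y' p := (h1 _ hq).tail hqp hyp.right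
      exact (hyp.trans h2.symm).trans (h1 z hz)
    have hlt : {z | Linked G (insert p U) y' z}.ncard < {z | Linked G (insert v U) y z}.ncard :=
      Set.ncard_lt_ncard ⟨key, fun h => (h hyp).right (Set.mem_insert _ _)⟩
    exact absurd (hmin p y' hp hy' hyN') (by omega)

theorem exists_equiv_fin_lt_iff {I α : Type*} [Fintype I] [LinearOrder α] {g : I → α}
    (hg : Function.Injective g) :
    ∃ e : I ≃ Fin (Fintype.card I), ∀ a b, e a < e b ↔ g a < g b := by
  let _ : LinearOrder I := LinearOrder.lift' g hg
  exact ⟨(Fintype.orderIsoFinOfCardEq I rfl).symm.toEquiv, fun a b =>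
    (Fintype.orderIsoFinOfCardEq I rfl).symm.lt_iff_lt⟩

/-- In a forest, the indices can be ordered such that the earlier indices are separated from the
later ones, at each index, by few vertices. -/
theorem SimpleGraph.IsAcyclic.exists_order [Finite V] (hG : G.IsAcyclic) {I : Type*} [Fintype I]
    (ω : I → V) (r : ℕ) : ∀ U : Set V, (∀ x, {i | Linked G U x (ω i)}.ncard < 2 ^ r) →
    ∃ e : I ≃ Fin (Fintype.card I), ∀ i, ω i ∉ U → ∃ W : Finset V, W.card ≤ r ∧ ω i ∈ W ∧
      ∀ a b, e a < e i → e i < e b → ¬ Linked G (U ∪ W) (ω a) (ω b) := by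
  classical
  rcases isEmpty_or_nonempty V with hV | hV
  · have := Function.isEmpty ω
    exact fun _ _ => ⟨Fintype.equivFin I, isEmptyElim⟩
  induction r with
  | zero =>
    intro U hU
    refine ⟨Fintype.equivFin I, fun i hi => ?_⟩
    have h := hU (ω i)
    rw [pow_zero, Nat.lt_one_iff, Set.ncard_eq_zero] at h
    exact absurd (show i ∈ {j | Linked G U (ω i) (ω j)} from .refl hi) (h ▸ Set.notMem_empty i)
  | succ r ih =>
    intro U hU
    let comp : V → Set V := fun x => {z | Linked G U x z}
    -- The centroid is chosen as a function of the component as a set, so that linked vertices get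
    -- the same one.
    have hcen : ∀ S : Set V, ∃ v, ∀ x, x ∉ U → S = comp x → Linked G U x v ∧
        ∀ y, Linked G U x y → {i | Linked G (insert v U) y (ω i)}.ncard < 2 ^ r := by
      intro S
      by_cases hS : ∃ x, x ∉ U ∧ S = comp x
      · obtain ⟨x, hx, rfl⟩ := hS
        obtain ⟨v, hv, hv'⟩ := hG.exists_centroid ω U (2 ^ r) hx
          (by simpa [pow_succ, mul_comm] using hU x)
        refine ⟨v, fun x' hx' h => ?_⟩
        have hxx : Linked G U x x' := by
          have : x' ∈ comp x := h ▸ Linked.refl hx'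
          exact this
        exact ⟨hxx.symm.trans hv, fun y hy => hv' y (hxx.trans hy)⟩
      · exact ⟨Classical.arbitrary V, fun x hx h => absurd ⟨x, hx, h⟩ hS⟩
    choose cen hcen using hcen
    let U' : Set V := {v | v ∈ U ∨ ∃ x, x ∉ U ∧ v = cen (comp x)}
    have hcenU : ∀ {x}, x ∉ U → Linked G U x (cen (comp x)) := fun hx => (hcen _ _ hx rfl).1
    have hU' : ∀ x, {i | Linked G U' x (ω i)}.ncard < 2 ^ r := by
      intro x
      by_cases hx : x ∈ U
      · have h0 : {i | Linked G U' x (ω i)} = ∅ :=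
          Set.eq_empty_of_forall_notMem fun i hi => hi.left (Or.inl hx)
        rw [h0, Set.ncard_empty]
        positivity
      · refine lt_of_le_of_lt (Set.ncard_le_ncard fun i hi => ?_)
          ((hcen _ x hx rfl).2 x (.refl hx))
        refine Linked.anti (Set.insert_subset ?_ fun z hz => ?_) hi
        · exact Or.inr ⟨x, hx, rfl⟩
        · exact Or.inl hz
    obtain ⟨e', he'⟩ := ih U' hU'
    -- Components are kept contiguous; within a component the indices at its centroid come first,
    -- and the rest follow the order given by induction.
    let key : I → ℕ ×ₗ (ℕ ×ₗ ℕ) := fun i =>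
      toLex ((Finite.equivFin (Set V) (comp (ω i)) : ℕ),
        toLex (if ω i ∈ U' then 0 else 1, (e' i : ℕ)))
    have hkey : Function.Injective key := by
      intro i j hij
      have h := congrArg (fun t => (ofLex (ofLex t).2).2) hij
      exact e'.injective (Fin.ext h)
    have hkey_lt : ∀ a b, key a < key b ↔
        (Finite.equivFin (Set V) (comp (ω a)) : ℕ) < Finite.equivFin (Set V) (comp (ω b)) ∨
        (Finite.equivFin (Set V) (comp (ω a)) : ℕ) = Finite.equivFin (Set V) (comp (ω b)) ∧
        ((if ω a ∈ U' then 0 else 1) < (if ω b ∈ U' then 0 else 1) ∨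
        (if ω a ∈ U' then 0 else 1) = (if ω b ∈ U' then 0 else 1) ∧ (e' a : ℕ) < e' b) := by
      intro a b
      simp only [key, Prod.Lex.toLex_lt_toLex]
    obtain ⟨e, he⟩ := exists_equiv_fin_lt_iff hkey
    refine ⟨e, fun i hi => ?_⟩
    -- A link from an earlier to a later index keeps `a`, `i`, `b` in one component. As it avoids
    -- the centroid of that component, it avoids all of `U'`, and the comparison reduces to `e'`.
    have main : ∀ W : Set V, cen (comp (ω i)) ∈ W → ∀ a b, e a < e i → e i < e b →
        Linked G (U ∪ W) (ω a) (ω b) →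
        e' a < e' i ∧ e' i < e' b ∧ ω i ∉ U' ∧ Linked G (U' ∪ W) (ω a) (ω b) := by
      intro W hW a b hai hib hab
      rw [he, hkey_lt] at hai hib
      have hab' : comp (ω a) = comp (ω b) := (hab.anti Set.subset_union_left).setOf_eq
      have hai' : comp (ω a) = comp (ω i) := by
        refine (Finite.equivFin (Set V)).injective (Fin.ext ?_)
        rw [← hab'] at hib
        omega
      have hL : Linked G (U' ∪ W) (ω a) (ω b) := by
        refine hab.imp fun z hz => ?_
        have hzr := hz.right
        simp only [Set.mem_union, not_or] at hzr ⊢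
        refine ⟨?_, hzr.2⟩
        rintro (h | ⟨x, hx, rfl⟩)
        · exact hzr.1 h
        · have h1 : comp x = comp (ω i) :=
            (hcenU hx).setOf_eq.trans
              ((hz.anti Set.subset_union_left).setOf_eq.symm.trans hai')
          exact hzr.2 (h1 ▸ hW)
      have ha : ω a ∉ U' := fun h => hL.left (Or.inl h)
      have hb : ω b ∉ U' := fun h => hL.right (Or.inl h)
      rw [← hab', ← hai'] at hib
      rw [← hai'] at hai
      simp only [ha, hb, if_false, lt_irrefl, true_and, false_or] at hai hib
      -- An index at the centroid could not come after `a`, which lies in the same component off the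
      -- centroid.
      have hi' : ω i ∉ U' := by
        intro h
        simp [h] at hai
      simp only [hi', if_false, lt_irrefl, true_and, false_or] at hai hib
      exact ⟨hai, hib, hi', hL⟩
    by_cases hiU : ω i ∈ U'
    · refine ⟨{cen (comp (ω i))}, by simp, ?_, fun a b hai hib hab => ?_⟩
      · rcases hiU with h | ⟨x, hx, hxi⟩
        · exact absurd h hi
        · have h1 : comp x = comp (ω i) := by
            have := (hcenU hx).setOf_eq
            rwa [← hxi] at this
          rw [Finset.mem_singleton, ← h1, hxi]
      · exact (main _ (by simp) a b hai hib hab).2.2.1 hiU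
    · obtain ⟨W, hW, hiW, hsep⟩ := he' i hiU
      refine ⟨insert (cen (comp (ω i))) W, (Finset.card_insert_le _ _).trans (by omega),
        Finset.mem_insert_of_mem hiW, fun a b hai hib hab => ?_⟩
      obtain ⟨h1, h2, -, h3⟩ := main _ (by simp) a b hai hib hab
      exact hsep a b h1 h2 (h3.anti (by
        rw [Finset.coe_insert]
        exact Set.union_subset_union_right _ (Set.subset_insert _ _)))

end Linked

/-! ### The dimension bound from a vertex separator in a realization. -/

section Cuts

variable {F : Type u} [Field F] {I : Type v}

/-- The subcode of the codewords of `C` that vanish outside `P`. -/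
def subcodeOn (C : Submodule F (I → F)) (P : Set I) : Submodule F (I → F) where
  carrier := {c | c ∈ C ∧ ∀ a, a ∉ P → c a = 0}
  add_mem' := fun ⟨h1, h2⟩ ⟨h3, h4⟩ => ⟨C.add_mem h1 h3, fun a ha => by
    simp [h2 a ha, h4 a ha]⟩
  zero_mem' := ⟨C.zero_mem, fun _ _ => rfl⟩
  smul_mem' := fun t _ ⟨h1, h2⟩ => ⟨C.smul_mem t h1, fun a ha => by simp [h2 a ha]⟩

theorem disjoint_subcodeOn (C : Submodule F (I → F)) {P Q : Set I} (h : Disjoint P Q) :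
    Disjoint (subcodeOn C P) (subcodeOn C Q) := by
  rw [Submodule.disjoint_def]
  intro c hP hQ
  funext a
  by_cases ha : a ∈ P
  · exact hQ.2 a (Set.disjoint_left.1 h ha)
  · exact hP.2 a ha

theorem finrank_sup_subcodeOn [Finite I] (C : Submodule F (I → F)) {P Q : Set I}
    (h : Disjoint P Q) :
    Module.finrank F ↥(subcodeOn C P ⊔ subcodeOn C Q) =
      Module.finrank F (subcodeOn C P) + Module.finrank F (subcodeOn C Q) := by
  have := Submodule.finrank_sup_add_finrank_inf_eq (subcodeOn C P) (subcodeOn C Q)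
  rwa [(disjoint_subcodeOn C h).eq_bot, finrank_bot, add_zero] at this

/-- Modulo the image of `B ⊓ ker φ`, which lies in `D`, the space `f(B)` is a quotient of `B / (B ⊓
ker φ) ≅ φ(B)`. -/
theorem Submodule.finrank_map_le_of_map_inf_ker_le {E E' P : Type*} [AddCommGroup E] [Module F E]
    [AddCommGroup E'] [Module F E'] [AddCommGroup P] [Module F P] [FiniteDimensional F E]
    [FiniteDimensional F E']
    (B : Submodule F E) (f : E →ₗ[F] E') (φ : E →ₗ[F] P) (D : Submodule F E')
    (h : ∀ b ∈ B, φ b = 0 → f b ∈ D) :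
    Module.finrank F (B.map f) ≤ Module.finrank F D + Module.finrank F (B.map φ) := by
  have h1 := LinearMap.finrank_range_add_finrank_ker (φ.domRestrict B)
  have h2 := LinearMap.finrank_range_add_finrank_ker (f.domRestrict B)
  have h3 := LinearMap.finrank_range_add_finrank_ker
    ((f.domRestrict B).domRestrict (LinearMap.ker (φ.domRestrict B)))
  have h4 : Module.finrank F (LinearMap.range
      ((f.domRestrict B).domRestrict (LinearMap.ker (φ.domRestrict B)))) ≤ Module.finrank F D := by
    refine Submodule.finrank_mono ?_
    rintro _ ⟨b, rfl⟩
    exact h b.1.1 b.1.2 b.2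
  have h5 : Module.finrank F (LinearMap.ker
      ((f.domRestrict B).domRestrict (LinearMap.ker (φ.domRestrict B)))) ≤
      Module.finrank F (LinearMap.ker (f.domRestrict B)) := by
    refine LinearMap.finrank_le_finrank_of_injective
      (f := (Submodule.subtype _ ∘ₗ Submodule.subtype _).codRestrict _ fun b => b.2) ?_
    intro b b' hb
    have := congrArg (fun t => (t : LinearMap.ker (f.domRestrict B)).1) hb
    exact Subtype.ext (Subtype.ext this)
  rw [LinearMap.range_domRestrict] at h1 h2
  omega

namespace GraphicalModel

variable {V : Type} {G : SimpleGraph V} {ω : I → V}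

theorem mem_behavior {Γ : GraphicalModel F G ω} {b : Γ.Config} :
    b ∈ Γ.behavior ↔ ∀ w, Γ.toLocal w b ∈ Γ.C w := by
  simp [behavior]

open Classical in
/-- The restriction of a configuration to a set of vertices and the edges that meet it. -/
noncomputable def restrict (Γ : GraphicalModel F G ω) (Z : Set V) (b : Γ.Config) : Γ.Config :=
  (fun i => if ω i ∈ Z then b.1 i else 0,
    fun e : G.edgeSet => @ite _ (∃ z ∈ Z, z ∈ (e : Sym2 V)) (Classical.dec _) (b.2 e) 0)

/-- A vertex of `Z` sees `b` unchanged, since all its edges meet `Z`. A vertex outside `Z` sees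
zero: if one of its edges meets `Z`, the closure condition puts the vertex in `W`, where `b`
vanishes locally. -/
theorem restrict_mem_behavior {Γ : GraphicalModel F G ω} {W Z : Set V} {b : Γ.Config}
    (hb : b ∈ Γ.behavior) (hW : ∀ w ∈ W, Γ.toLocal w b = 0)
    (hZ : ∀ y z, z ∈ Z → G.Adj z y → y ∉ W → y ∈ Z) : Γ.restrict Z b ∈ Γ.behavior := by
  rw [mem_behavior] at hb ⊢
  intro w
  by_cases hw : w ∈ Z
  · have : Γ.toLocal w (Γ.restrict Z b) = Γ.toLocal w b := by
      refine Prod.ext (funext fun i => ?_) (funext fun e => ?_)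
      · exact if_pos (by rw [i.2]; exact hw)
      · exact if_pos ⟨w, hw, e.2⟩
    rw [this]
    exact hb w
  · have : Γ.toLocal w (Γ.restrict Z b) = 0 := by
      refine Prod.ext (funext fun i => ?_) (funext fun e => ?_)
      · exact if_neg (by rw [i.2]; exact hw)
      · change @ite _ _ (Classical.dec _) (b.2 e.1) 0 = 0
        split_ifs with h
        · obtain ⟨z, hz, hze⟩ := h
          by_cases hwW : w ∈ W
          · exact congrFun (congrArg Prod.snd (hW w hwW)) e
          · have hzw : z ≠ w := fun h => hw (h ▸ hz)
            have hadj : G.Adj z w := by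
              have h1 : (e.1 : Sym2 V) = s(z, w) :=
                (Sym2.mem_and_mem_iff hzw).1 ⟨hze, e.2⟩
              have h2 := e.1.2
              rwa [h1] at h2
            exact absurd (hZ w z hz hadj hwW) hw
        · rfl
    rw [this]
    exact (Γ.C w).zero_mem

/-- If the vertices in `W` separate the indices in `P` from those in `Q`, and hold all other
indices, then the local constraint codes at `W` account for the codewords that do not split. -/
theorem Realizes.finrank_le [Finite I] [Fintype V] {Γ : GraphicalModel F G ω}
    {C : Submodule F (I → F)} (h : Γ.Realizes C) (W : Finset V) (P Q : Set I)
    (hPQ : ∀ i, ω i ∉ W → i ∈ P ∨ i ∈ Q)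
    (hsep : ∀ a ∈ P, ∀ b ∈ Q, ¬ Linked G W (ω a) (ω b)) :
    Module.finrank F C ≤
      Module.finrank F ↥(subcodeOn C P ⊔ subcodeOn C Q) + W.card * Γ.kappa := by
  -- A configuration killed by `φ` can be cut along `W`, so its codeword splits; the image of `φ` on
  -- the behavior lies in the product of the `Γ.C w` over `W`.
  let φ : Γ.Config →ₗ[F] (∀ w : W, Γ.LocalConfig w) := LinearMap.pi fun w => Γ.toLocal w
  have h1 : Module.finrank F (Γ.behavior.map Γ.toSymbols) ≤
      Module.finrank F ↥(subcodeOn C P ⊔ subcodeOn C Q) +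
        Module.finrank F (Γ.behavior.map φ) := by
    refine Submodule.finrank_map_le_of_map_inf_ker_le _ _ _ _ fun b hb hφ => ?_
    have hW : ∀ w ∈ (W : Set V), Γ.toLocal w b = 0 := fun w hw => congrFun hφ ⟨w, hw⟩
    have hbW : ∀ i, ω i ∈ W → b.1 i = 0 := fun i hi =>
      congrFun (congrArg Prod.fst (hW (ω i) hi)) ⟨i, rfl⟩
    let Z : Set V := {y | ∃ a ∈ P, Linked G W (ω a) y}
    have hr : Γ.restrict Z b ∈ Γ.behavior := by
      exact restrict_mem_behavior hb hW fun y z ⟨a, ha, hz⟩ hadj hy => ⟨a, ha, hz.tail hadj hy⟩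
    have hmem : ∀ b ∈ Γ.behavior, b.1 ∈ C := fun b hb => h.2 ▸ ⟨b, hb, rfl⟩
    have hsplit : Γ.toSymbols b = (Γ.restrict Z b).1 + (b.1 - (Γ.restrict Z b).1) := by
      rw [add_sub_cancel]
      rfl
    have hval : ∀ i, ω i ∈ Z → (Γ.restrict Z b).1 i = b.1 i := fun i hi => if_pos hi
    have hval0 : ∀ i, ω i ∉ Z → (Γ.restrict Z b).1 i = 0 := fun i hi => if_neg hi
    rw [hsplit]
    refine Submodule.add_mem_sup ⟨hmem _ hr, fun i hi => ?_⟩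
      ⟨C.sub_mem (hmem _ hb) (hmem _ hr), fun i hi => ?_⟩
    · by_cases hiZ : ω i ∈ Z
      · rw [hval i hiZ]
        refine hbW i ?_
        by_contra hiW
        obtain ⟨a, ha, hai⟩ := hiZ
        exact hsep a ha i ((hPQ i hiW).resolve_left hi) hai
      · exact hval0 i hiZ
    · rw [Pi.sub_apply]
      by_cases hiZ : ω i ∈ Z
      · rw [hval i hiZ, sub_self]
      · rw [hval0 i hiZ, sub_zero]
        refine hbW i ?_
        by_contra hiW
        exact hiZ ⟨i, (hPQ i hiW).resolve_right hi, .refl hiW⟩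
  have h2 : Module.finrank F (Γ.behavior.map φ) ≤ W.card * Γ.kappa := by
    have hle : Γ.behavior.map φ ≤ Submodule.pi Set.univ fun w : W => Γ.C w := by
      rintro _ ⟨b, hb, rfl⟩ w -
      exact mem_behavior.1 hb w
    refine (Submodule.finrank_mono hle).trans ?_
    have e : (Submodule.pi Set.univ fun w : W => Γ.C w) ≃ₗ[F] (∀ w : W, Γ.C w) :=
      { toFun := fun x w => ⟨x.1 w, x.2 w trivial⟩
        invFun := fun x => ⟨fun w => x w, fun w _ => (x w).2⟩
        map_add' := fun _ _ => rfl
        map_smul' := fun _ _ => rfl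
        left_inv := fun _ => rfl
        right_inv := fun _ => rfl }
    rw [e.finrank_eq, Module.finrank_pi_fintype]
    calc ∑ w : W, Module.finrank F (Γ.C w) ≤ ∑ _w : W, Γ.kappa :=
          Finset.sum_le_sum fun w _ =>
            Finset.le_sup (f := fun w : V => Module.finrank F (Γ.C w)) (Finset.mem_univ (w : V))
      _ = W.card * Γ.kappa := by simp
  rw [h.2] at h1
  omega

end GraphicalModel

end Cuts

/-! ### A path realization built from an assignment of the indices to a path. -/

section PathModel

variable {F : Type u} [Field F] {I : Type v}

/-- Setting the coordinates outside `P` to zero. -/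
noncomputable def truncation (F : Type u) [Field F] (P : Set I) : (I → F) →ₗ[F] (I → F) where
  toFun c := P.indicator c
  map_add' c d := Set.indicator_add P c d
  map_smul' t c := Set.indicator_const_smul P t c

theorem truncation_of_mem {P : Set I} {i : I} (h : i ∈ P) (c : I → F) :
    truncation F P c i = c i := Set.indicator_of_mem h c

theorem truncation_of_notMem {P : Set I} {i : I} (h : i ∉ P) (c : I → F) :
    truncation F P c i = 0 := Set.indicator_of_notMem h c

/-- The codewords of `C` that stay in `C` when the coordinates outside `P` are set to zero. -/
noncomputable def splitting (C : Submodule F (I → F)) (P : Set I) : Submodule F C :=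
  C.comap (truncation F P ∘ₗ C.subtype)

theorem mem_splitting {C : Submodule F (I → F)} {P : Set I} {c : C} :
    c ∈ splitting C P ↔ truncation F P c ∈ C := Iff.rfl

theorem mem_splitting_of_subset {C : Submodule F (I → F)} {P : Set I} {c : C}
    (h : ∀ a, a ∉ P → (c : I → F) a = 0) : c ∈ splitting C P := by
  rw [mem_splitting]
  convert c.2
  funext a
  by_cases ha : a ∈ P
  · exact truncation_of_mem ha _
  · rw [truncation_of_notMem ha, h a ha]

theorem mem_splitting_of_disjoint {C : Submodule F (I → F)} {P : Set I} {c : C}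
    (h : ∀ a, a ∈ P → (c : I → F) a = 0) : c ∈ splitting C P := by
  rw [mem_splitting]
  convert C.zero_mem
  funext a
  by_cases ha : a ∈ P
  · rw [truncation_of_mem ha, h a ha]; rfl
  · exact truncation_of_notMem ha _

variable {n : ℕ}

/-- The indices on the first side of an edge of a path. -/
def before (ω : I → Fin n) (e : (SimpleGraph.pathGraph n).edgeSet) : Set I :=
  {a | ω a ≤ (e : Sym2 (Fin n)).inf}

/-- The map that sends a codeword `c` to its coordinates at `w` and its states `q e c` at the edges
incident with `w`. -/
def localMap {V : Type} {G : SimpleGraph V} (C : Submodule F (I → F)) (ω : I → V)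
    {S : G.edgeSet → Type*} [∀ e, AddCommGroup (S e)] [∀ e, Module F (S e)]
    (q : ∀ e, C →ₗ[F] S e) (w : V) :
    C →ₗ[F] ({i : I // ω i = w} → F) × (∀ e : {e : G.edgeSet // w ∈ (e : Sym2 V)}, S e.1) where
  toFun c := (fun i => c.1 i.1, fun e => q e.1 c)
  map_add' c d := Prod.ext rfl (funext fun e => map_add (q e.1) c d)
  map_smul' t c := Prod.ext rfl (funext fun e => map_smul (q e.1) t c)

theorem finrank_range_localMap [Finite I] {V : Type} {G : SimpleGraph V} (C : Submodule F (I → F))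
    (ω : I → V) {S : G.edgeSet → Type*} [∀ e, AddCommGroup (S e)] [∀ e, Module F (S e)]
    (q : ∀ e, C →ₗ[F] S e) (w : V) :
    Module.finrank F (LinearMap.range (localMap C ω q w)) +
      Module.finrank F (LinearMap.ker (localMap C ω q w)) = Module.finrank F C :=
  LinearMap.finrank_range_add_finrank_ker _

/-- The model whose local constraint codes are the images of `C` under `localMap`. -/
def imageModel {V : Type} {G : SimpleGraph V} (C : Submodule F (I → F)) (ω : I → V)
    {S : G.edgeSet → Type (max u v)} [∀ e, AddCommGroup (S e)] [∀ e, Module F (S e)]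
    [∀ e, FiniteDimensional F (S e)] (q : ∀ e, C →ₗ[F] S e) : GraphicalModel F G ω where
  S := S
  C w := LinearMap.range (localMap C ω q w)

theorem edge_eq_of_mem {w : Fin n} {e : (SimpleGraph.pathGraph n).edgeSet}
    (h : w ∈ (e : Sym2 (Fin n))) :
    (e : Sym2 (Fin n)).inf = w ∨ ((e : Sym2 (Fin n)).inf : ℕ) + 1 = w := by
  obtain ⟨e, he⟩ := e
  induction e with
  | _ x y =>
    rw [SimpleGraph.mem_edgeSet, SimpleGraph.pathGraph_adj] at he
    simp only [Sym2.mem_iff] at h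
    simp only [Sym2.inf_mk]
    rcases he with he | he
    · have hxy : x ≤ y := by rw [Fin.le_def]; omega
      rw [inf_eq_left.2 hxy]
      rcases h with rfl | rfl
      · exact .inl rfl
      · exact .inr he
    · have hxy : y ≤ x := by rw [Fin.le_def]; omega
      rw [inf_eq_right.2 hxy]
      rcases h with rfl | rfl
      · exact .inr he
      · exact .inl rfl

theorem edge_mem (e : (SimpleGraph.pathGraph n).edgeSet) :
    (e : Sym2 (Fin n)).inf ∈ (e : Sym2 (Fin n)) ∧
    ∃ w : Fin n, ((e : Sym2 (Fin n)).inf : ℕ) + 1 = w ∧ w ∈ (e : Sym2 (Fin n)) := by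
  obtain ⟨e, he⟩ := e
  induction e with
  | _ x y =>
    rw [SimpleGraph.mem_edgeSet, SimpleGraph.pathGraph_adj] at he
    simp only [Sym2.inf_mk, Sym2.mem_iff]
    rcases he with he | he
    · have hxy : x ≤ y := by rw [Fin.le_def]; omega
      rw [inf_eq_left.2 hxy]
      exact ⟨.inl rfl, y, he, .inr rfl⟩
    · have hxy : y ≤ x := by rw [Fin.le_def]; omega
      rw [inf_eq_right.2 hxy]
      exact ⟨.inr rfl, x, he, .inl rfl⟩

variable {S : (SimpleGraph.pathGraph n).edgeSet → Type (max u v)} [∀ e, AddCommGroup (S e)]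
  [∀ e, Module F (S e)] [∀ e, FiniteDimensional F (S e)]

/-- If the states of a codeword are its classes modulo the codewords that split at the edge, then
the full behavior consists of the codewords with their states. -/
theorem mem_behavior_imageModel [NeZero n] (C : Submodule F (I → F)) (ω : I → Fin n)
    (q : ∀ e, C →ₗ[F] S e) (hq : ∀ e c, q e c = 0 ↔ c ∈ splitting C (before ω e))
    (b : (imageModel C ω q).Config) : b ∈ (imageModel C ω q).behavior ↔
      ∃ c : C, b = ((c : I → F), fun e => q e c) := by
  rw [GraphicalModel.mem_behavior]
  constructor
  · intro h
    choose c hc using h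
    have h1 : ∀ i : I, (c (ω i) : I → F) i = b.1 i := fun i =>
      congrFun (congrArg Prod.fst (hc (ω i))) ⟨i, rfl⟩
    have h2 : ∀ (w : Fin n) (e : (SimpleGraph.pathGraph n).edgeSet), w ∈ (e : Sym2 (Fin n)) →
        q e (c w) = b.2 e :=
      fun w e he => congrFun (congrArg Prod.snd (hc w)) ⟨e, he⟩
    -- The local codewords `c w` are glued from left to right; `j` is the last vertex already
    -- matched.
    have key : ∀ j : ℕ, j < n → ∃ c : C, (∀ i, (ω i : ℕ) ≤ j → (c : I → F) i = b.1 i) ∧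
        ∀ e : (SimpleGraph.pathGraph n).edgeSet, ((e : Sym2 (Fin n)).inf : ℕ) ≤ j →
          q e c = b.2 e := by
      intro j
      induction j with
      | zero =>
        intro hj
        refine ⟨c ⟨0, hj⟩, fun i hi => ?_, fun e he => h2 _ e ?_⟩
        · have : ω i = ⟨0, hj⟩ := Fin.ext (by simpa using hi)
          rw [← this, h1]
        · have : (e : Sym2 (Fin n)).inf = ⟨0, hj⟩ := Fin.ext (by simpa using he)
          exact this ▸ (edge_mem e).1
      | succ j ih =>
        intro hj
        obtain ⟨d, hd1, hd2⟩ := ih (by omega)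
        let w : Fin n := ⟨j + 1, hj⟩
        have hadj : (SimpleGraph.pathGraph n).Adj ⟨j, by omega⟩ w := by
          simp [SimpleGraph.pathGraph_adj, w]
        let e₀ : (SimpleGraph.pathGraph n).edgeSet := ⟨s(⟨j, by omega⟩, w), hadj⟩
        have he₀ : ((e₀ : Sym2 (Fin n)).inf : ℕ) = j := by
          simp [e₀, w]
        -- Equal states at `e₀` mean that `d - c w` splits there, so its truncation `t` is a
        -- codeword, and `c w + t` follows `d` up to `j` and `c w` afterwards.
        have hsp : d - c w ∈ splitting C (before ω e₀) := by
          rw [← hq, map_sub, sub_eq_zero]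
          exact (hd2 e₀ he₀.le).trans (h2 w e₀ (Sym2.mem_mk_right _ _)).symm
        rw [mem_splitting] at hsp
        let t : C := ⟨_, hsp⟩
        have ht : ∀ i, (ω i : ℕ) ≤ j → (t : I → F) i = (d : I → F) i - (c w : I → F) i :=
          fun i hi => truncation_of_mem
            (P := before ω e₀)
            (show ω i ≤ _ from Fin.le_def.2 (by rw [he₀]; exact hi)) _
        have ht0 : ∀ i, ¬ (ω i : ℕ) ≤ j → (t : I → F) i = 0 :=
          fun i hi => truncation_of_notMem (P := before ω e₀)
            (fun h : ω i ≤ _ => hi (by rw [Fin.le_def, he₀] at h; exact h)) _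
        refine ⟨c w + t, fun i hi => ?_, fun e he => ?_⟩
        · change (c w : I → F) i + (t : I → F) i = _
          by_cases hij : (ω i : ℕ) ≤ j
          · rw [ht i hij, add_sub_cancel, hd1 i hij]
          · have : ω i = w := Fin.ext (show (ω i : ℕ) = j + 1 by omega)
            rw [ht0 i hij, add_zero, ← this, h1]
        -- At an edge starting at or before `j`, the new codeword minus `d` vanishes on the first
        -- side. At an edge starting at `j + 1`, the new codeword minus `c w` is `t`, which vanishes
        -- on the second side.
        · by_cases hej : ((e : Sym2 (Fin n)).inf : ℕ) ≤ j
          · rw [← hd2 e hej]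
            refine sub_eq_zero.1 ((map_sub _ _ _).symm.trans ((hq e _).2 (mem_splitting_of_disjoint fun a ha => ?_)))
            have ha' : (ω a : ℕ) ≤ j := (Fin.le_def.1 ha).trans hej
            change (c w : I → F) a + (t : I → F) a - (d : I → F) a = 0
            rw [ht a ha', add_sub_cancel, sub_self]
          · have hew : (e : Sym2 (Fin n)).inf = w :=
              Fin.ext (show ((e : Sym2 (Fin n)).inf : ℕ) = j + 1 by omega)
            rw [← h2 w e (hew ▸ (edge_mem e).1)]
            refine sub_eq_zero.1 ((map_sub _ _ _).symm.trans ((hq e _).2 (mem_splitting_of_subset fun a ha => ?_)))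
            have ha' : ¬ (ω a : ℕ) ≤ j := fun h => ha (show ω a ≤ _ from Fin.le_def.2 (by omega))
            change (c w : I → F) a + (t : I → F) a - (c w : I → F) a = 0
            rw [ht0 a ha', add_zero, sub_self]
    obtain ⟨d, hd1, hd2⟩ := key (n - 1) (by have := NeZero.pos n; omega)
    refine ⟨d, Prod.ext (funext fun i => (hd1 i (by omega)).symm)
      (funext fun e => (hd2 e (by omega)).symm)⟩
  · rintro ⟨c, rfl⟩ w
    exact ⟨c, rfl⟩

theorem imageModel_realizes [NeZero n] (C : Submodule F (I → F)) (ω : I → Fin n)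
    (q : ∀ e, C →ₗ[F] S e) (hq : ∀ e c, q e c = 0 ↔ c ∈ splitting C (before ω e))
    (hsurj : ∀ e, Function.Surjective (q e)) : (imageModel C ω q).Realizes C := by
  refine ⟨⟨fun w => ?_, fun e => ?_⟩, ?_⟩
  · ext z
    constructor
    · rintro ⟨b, hb, rfl⟩
      exact GraphicalModel.mem_behavior.1 hb w
    · rintro ⟨c, rfl⟩
      exact ⟨_, (mem_behavior_imageModel C ω q hq _).2 ⟨c, rfl⟩, rfl⟩
  · refine eq_top_iff.2 fun s _ => ?_
    obtain ⟨c, rfl⟩ := hsurj e s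
    exact ⟨_, (mem_behavior_imageModel C ω q hq _).2 ⟨c, rfl⟩, rfl⟩
  · ext x
    constructor
    · rintro ⟨b, hb, rfl⟩
      obtain ⟨c, rfl⟩ := (mem_behavior_imageModel C ω q hq _).1 hb
      exact c.2
    · intro hx
      exact ⟨_, (mem_behavior_imageModel C ω q hq _).2 ⟨⟨x, hx⟩, rfl⟩, rfl⟩

/-- Codewords supported strictly before or strictly after `w` vanish at `w` and split at each of its
edges, so their sums lie in the kernel of `localMap`; rank–nullity does the rest. -/
theorem finrank_imageModel_le [Finite I] (C : Submodule F (I → F)) (ω : I → Fin n)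
    (q : ∀ e, C →ₗ[F] S e) (hq : ∀ e c, q e c = 0 ↔ c ∈ splitting C (before ω e)) (w : Fin n) :
    Module.finrank F ((imageModel C ω q).C w) +
      Module.finrank F ↥(subcodeOn C {a | ω a < w} ⊔ subcodeOn C {a | w < ω a}) ≤
      Module.finrank F C := by
  have h1 : Module.finrank F ((imageModel C ω q).C w) =
      Module.finrank F (LinearMap.range (localMap C ω q w)) := rfl
  have h2 := finrank_range_localMap C ω q w
  suffices h : Module.finrank F ↥(subcodeOn C {a | ω a < w} ⊔ subcodeOn C {a | w < ω a}) ≤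
      Module.finrank F (LinearMap.ker (localMap C ω q w)) by omega
  have hle : subcodeOn C {a | ω a < w} ⊔ subcodeOn C {a | w < ω a} ≤
      (LinearMap.ker (localMap C ω q w)).map C.subtype := by
    refine sup_le ?_ ?_
    · rintro c ⟨hc, hc0⟩
      refine ⟨⟨c, hc⟩, ?_, rfl⟩
      refine Prod.ext (funext fun i => hc0 _ ?_) (funext fun e => ?_)
      · simp [i.2]
      · refine (hq _ _).2 (mem_splitting_of_subset fun a ha => hc0 _ ?_)
        intro (h : ω a < w)
        refine ha (show ω a ≤ _ from Fin.le_def.2 ?_)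
        rw [Fin.lt_def] at h
        rcases edge_eq_of_mem e.2 with h' | h'
        · rw [h']; omega
        · omega
    · rintro c ⟨hc, hc0⟩
      refine ⟨⟨c, hc⟩, ?_, rfl⟩
      refine Prod.ext (funext fun i => hc0 _ ?_) (funext fun e => ?_)
      · simp [i.2]
      · refine (hq _ _).2 (mem_splitting_of_disjoint fun a ha => hc0 _ ?_)
        intro (h : w < ω a)
        have ha' : ω a ≤ _ := ha
        rw [Fin.le_def] at ha'
        rw [Fin.lt_def] at h
        rcases edge_eq_of_mem e.2 with h' | h'
        · rw [h'] at ha'; omega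
        · omega
  refine (Submodule.finrank_mono hle).trans ?_
  exact Submodule.finrank_map_le _ _

theorem codePathwidth_le_kappa [Finite I] {m : ℕ} {C : Submodule F (I → F)} {ω : I → Fin (m + 2)}
    {Γ : GraphicalModel F (SimpleGraph.pathGraph (m + 2)) ω} (hΓ : Γ.Realizes C) :
    codePathwidth C ≤ Γ.kappa := by
  have h1 : codePathwidth C ≤ kappaGraph C (SimpleGraph.pathGraph (m + 2)) :=
    Nat.sInf_le ⟨Fin (m + 2), inferInstance, _, ⟨m, ⟨SimpleGraph.Iso.refl⟩⟩, rfl⟩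
  have h2 : kappaGraph C (SimpleGraph.pathGraph (m + 2)) ≤ kappaDecomposition C _ ω :=
    Nat.sInf_le ⟨ω, rfl⟩
  exact h1.trans (h2.trans (Nat.sInf_le ⟨Γ, hΓ, rfl⟩))

theorem kappa_imageModel_le [Finite I] (C : Submodule F (I → F)) (ω : I → Fin n)
    (q : ∀ e, C →ₗ[F] S e) (hq : ∀ e c, q e c = 0 ↔ c ∈ splitting C (before ω e)) (K : ℕ)
    (hK : ∀ w, Module.finrank F C ≤
      Module.finrank F ↥(subcodeOn C {a | ω a < w} ⊔ subcodeOn C {a | w < ω a}) + K) :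
    (imageModel C ω q).kappa ≤ K := by
  refine Finset.sup_le fun w _ => ?_
  have := finrank_imageModel_le C ω q hq w
  have := hK w
  omega

theorem codePathwidth_le [Finite I] (C : Submodule F (I → F)) {m : ℕ} (ω : I → Fin (m + 2)) (K : ℕ)
    (hK : ∀ w, Module.finrank F C ≤
      Module.finrank F ↥(subcodeOn C {a | ω a < w} ⊔ subcodeOn C {a | w < ω a}) + K) :
    codePathwidth C ≤ K := by
  have hq : ∀ e c, (splitting C (before ω e)).mkQ c = 0 ↔ c ∈ splitting C (before ω e) :=
    fun e c => Submodule.Quotient.mk_eq_zero _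
  exact (codePathwidth_le_kappa (imageModel_realizes C ω _ hq
    fun e => Submodule.mkQ_surjective _)).trans (kappa_imageModel_le C ω _ hq K hK)

end PathModel

/-! ### Order costs against dimension and minimum distance. -/

section Distance

variable {F : Type u} [Field F] {I : Type v} [Fintype I]

theorem minDist_le_ncard {C : Submodule F (I → F)} {c : I → F} (hc : c ∈ C) (h0 : c ≠ 0) :
    minDist C ≤ {a | c a ≠ 0}.ncard := by
  classical
  have h : minDist C ≤ @hammingDist I (fun _ => F) _
      (fun _ a b => Classical.propDecidable (a = b)) c 0 :=
    Nat.sInf_le ⟨c, hc, 0, C.zero_mem, h0, rfl⟩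
  refine h.trans ?_
  rw [Set.ncard_eq_toFinset_card', hammingDist]
  refine Finset.card_le_card fun a ha => ?_
  simpa using ha

theorem minDist_pos {C : Submodule F (I → F)} (hC : C ≠ ⊥) : 0 < minDist C := by
  obtain ⟨c, hc, h0⟩ := Submodule.exists_mem_ne_zero_of_ne_bot hC
  obtain ⟨x, -, y, -, hxy, h⟩ := Nat.sInf_mem
    (s := {r : ℕ | ∃ x ∈ C, ∃ y ∈ C, x ≠ y ∧ r = @hammingDist I (fun _ => F) _
      (fun _ a b => Classical.propDecidable (a = b)) x y}) ⟨_, c, hc, 0, C.zero_mem, h0, rfl⟩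
  rw [minDist, h]
  classical
  exact hammingDist_pos.2 hxy

theorem eq_zero_of_support_lt_minDist {C : Submodule F (I → F)} {c : I → F} (hc : c ∈ C)
    {n : ℕ} (e : I ≃ Fin n) (l m : ℕ) (hlm : m - l < minDist C)
    (h : ∀ a, c a ≠ 0 → l ≤ e a ∧ (e a : ℕ) < m) : c = 0 := by
  by_contra h0
  have h1 := minDist_le_ncard hc h0
  have h2 : {a | c a ≠ 0}.ncard ≤ (Finset.Ico l m : Set ℕ).ncard :=
    Set.ncard_le_ncard_of_injOn (fun a => (e a : ℕ)) (fun a ha => by simpa using h a ha)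
      (fun a _ b _ hab => e.injective (Fin.ext hab))
  rw [Set.ncard_coe_finset, Nat.card_Ico] at h2
  omega

/-- If at each index few codewords fail to split into a past and a future part, then the code has
small dimension or small minimum distance. -/
theorem finrank_mul_minDist_le (C : Submodule F (I → F)) {n : ℕ} (e : I ≃ Fin n) (K : ℕ)
    (hK : ∀ i, Module.finrank F C ≤
      Module.finrank F ↥(subcodeOn C {a | e a < i} ⊔ subcodeOn C {a | i < e a}) + K) :
    Module.finrank F C * minDist C ≤ n * K := by
  set d := minDist C with hd
  rcases Nat.eq_zero_or_pos d with hd0 | hdpos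
  · simp [hd0]
  let p : ℕ → ℕ := fun j => Module.finrank F (subcodeOn C {a | (e a : ℕ) < j})
  let q : ℕ → ℕ := fun j => Module.finrank F (subcodeOn C {a | j ≤ (e a : ℕ)})
  -- The two supports overlap in a window of `d - 1` positions, too short for a nonzero codeword, so
  -- the two subcodes are independent.
  have hpq : ∀ j, q (j + 1) + p (j + d) ≤ Module.finrank F C := by
    intro j
    have h := Submodule.finrank_sup_add_finrank_inf_eq (subcodeOn C {a | j + 1 ≤ (e a : ℕ)})
      (subcodeOn C {a | (e a : ℕ) < j + d})
    have h0 : subcodeOn C {a | j + 1 ≤ (e a : ℕ)} ⊓ subcodeOn C {a | (e a : ℕ) < j + d} = ⊥ := by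
      refine (Submodule.eq_bot_iff _).2 fun c hc => ?_
      refine eq_zero_of_support_lt_minDist hc.1.1 e (j + 1) (j + d) (by omega) fun a ha => ?_
      exact ⟨by_contra fun h => ha (hc.1.2 a h), by_contra fun h => ha (hc.2.2 a h)⟩
    rw [h0, finrank_bot, add_zero] at h
    change Module.finrank F (subcodeOn C _) + Module.finrank F (subcodeOn C _) ≤ _
    rw [← h]
    exact Submodule.finrank_mono (sup_le (fun c hc => hc.1) fun c hc => hc.1)
  -- The cost bound at `i` reads `k ≤ p i + q (i + 1) + K`; combined with `hpq` it eliminates `q`.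
  have hstep : ∀ i ∈ Finset.range n, p (d + i) ≤ p i + K := by
    intro i hi
    have h1 := hK ⟨i, Finset.mem_range.1 hi⟩
    have hdisj : Disjoint {a | e a < ⟨i, Finset.mem_range.1 hi⟩}
        {a | ⟨i, Finset.mem_range.1 hi⟩ < e a} :=
      Set.disjoint_left.2 fun a (h : e a < _) h' => lt_asymm h h'
    rw [finrank_sup_subcodeOn C hdisj] at h1
    have h2 := hpq i
    have h3 : p i = Module.finrank F (subcodeOn C {a | e a < ⟨i, Finset.mem_range.1 hi⟩}) := rfl
    have h4 : q (i + 1) = Module.finrank F (subcodeOn C {a | ⟨i, Finset.mem_range.1 hi⟩ < e a}) :=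
      rfl
    rw [add_comm d i]
    omega
  have hend : ∀ j ∈ Finset.range d, p (n + j) = Module.finrank F C := by
    intro j _
    have : subcodeOn C {a | (e a : ℕ) < n + j} = C :=
      le_antisymm (fun c hc => hc.1) fun c hc => ⟨hc, fun a ha => absurd
        (show (e a : ℕ) < n + j from (e a).2.trans_le (Nat.le_add_right _ _)) ha⟩
    exact congrArg (fun D : Submodule F (I → F) => Module.finrank F D) this
  -- The sum of `p (d + i) - p i` over `i < n` telescopes to the last `d` values of `p`, all equal
  -- to `k`, minus the first `d` values, all zero.
  have hsum := Finset.sum_le_sum hstep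
  have h1 := Finset.sum_range_add p n d
  have h2 := Finset.sum_range_add p d n
  rw [Finset.sum_congr rfl hend] at h1
  rw [add_comm d n] at h2
  simp only [Finset.sum_add_distrib, Finset.sum_const, Finset.card_range, smul_eq_mul] at hsum h1
  have h3 : ∑ i ∈ Finset.range d, p i = 0 := by
    refine Finset.sum_eq_zero fun j hj => ?_
    have : subcodeOn C {a | (e a : ℕ) < j} = ⊥ := by
      refine (Submodule.eq_bot_iff _).2 fun c hc => ?_
      refine eq_zero_of_support_lt_minDist hc.1 e 0 j (by have := Finset.mem_range.1 hj; omega)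
        fun a ha => ⟨Nat.zero_le _, by_contra fun h => ha (hc.2 a h)⟩
    change Module.finrank F (subcodeOn C _) = 0
    rw [this, finrank_bot]
  rw [mul_comm]
  omega

end Distance

/-! ### Optimal realizations and the two width inequalities. -/

section Widths

variable {F : Type u} [Field F] {I : Type v}

/-- The infimum of an empty set of naturals is `0`, so each of the three nested minima must be shown
to be attained; connectedness supplies both an index map and a realization. -/
theorem exists_kappa_eq_kappaFamily [Finite I] (C : Submodule F (I → F))
    {family : ∀ V : Type, SimpleGraph V → Prop} (hconn : ∀ V G, family V G → G.Connected)
    {V₀ : Type} [Fintype V₀] {G₀ : SimpleGraph V₀} (h₀ : family V₀ G₀) :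
    ∃ (V : Type) (_ : Fintype V) (G : SimpleGraph V), family V G ∧
      ∃ (ω : I → V) (Γ : GraphicalModel F G ω), Γ.Realizes C ∧ Γ.kappa = kappaFamily C family := by
  obtain ⟨V, hV, G, hG, h1⟩ := Nat.sInf_mem (s := {r : ℕ | ∃ (V : Type) (_ : Fintype V)
    (G : SimpleGraph V), family V G ∧ r = kappaGraph C G}) ⟨_, V₀, inferInstance, G₀, h₀, rfl⟩
  have hc := hconn V G hG
  obtain ⟨ω, h2⟩ := Nat.sInf_mem (s := {r : ℕ | ∃ ω : I → V, r = kappaDecomposition C G ω})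
    ⟨_, fun _ => hc.nonempty.some, rfl⟩
  obtain ⟨Γ₀, hΓ₀⟩ := exists_realizes C G hc ω
  obtain ⟨Γ, hΓ, h3⟩ := Nat.sInf_mem (s := {r : ℕ | ∃ Γ : GraphicalModel F G ω,
    Γ.Realizes C ∧ r = Γ.kappa}) ⟨_, Γ₀, hΓ₀, rfl⟩
  exact ⟨V, hV, G, hG, ω, Γ, hΓ, h3.symm.trans (h2.symm.trans h1.symm)⟩

theorem IsPathGraph.connected {V : Type} {G : SimpleGraph V} (h : IsPathGraph G) :
    G.Connected := by
  obtain ⟨m, ⟨φ⟩⟩ := h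
  exact φ.connected_iff.2 (SimpleGraph.pathGraph_connected (m + 1))

/-- On a path, a vertex separates the earlier vertices from the later ones. -/
theorem Linked.lt_of_lt {V : Type*} {G : SimpleGraph V} {n : ℕ}
    (φ : G ≃g SimpleGraph.pathGraph n) {U : Set V} {v x y : V} (h : Linked G U x y) (hv : v ∈ U)
    (hx : φ x < φ v) : φ y < φ v := by
  obtain ⟨h1, h2⟩ := h
  induction h2 with
  | refl => exact hx
  | @tail b c _ h ih =>
    -- Adjacent positions differ by one, so a walk cannot pass `v` without meeting it.
    have hadj := φ.map_adj_iff.2 h.1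
    rw [SimpleGraph.pathGraph_adj] at hadj
    have hne : (φ c : ℕ) ≠ φ v := fun hcv =>
      h.2 (φ.injective (Fin.ext hcv) ▸ hv)
    rw [Fin.lt_def] at ih ⊢
    omega

variable [Fintype I]

theorem codePathwidth_le_of_equiv (C : Submodule F (I → F)) {n : ℕ} (hn : 1 < n) (e : I ≃ Fin n)
    (K : ℕ) (hK : ∀ i, Module.finrank F C ≤
      Module.finrank F ↥(subcodeOn C {a | e a < i} ⊔ subcodeOn C {a | i < e a}) + K) :
    codePathwidth C ≤ K := by
  obtain ⟨m, rfl⟩ : ∃ m, n = m + 2 := ⟨n - 2, by omega⟩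
  exact codePathwidth_le C e K hK

theorem finrank_mul_minDist_le_codePathwidth (C : Submodule F (I → F)) :
    Module.finrank F C * minDist C ≤ Fintype.card I * codePathwidth C := by
  obtain ⟨V, _, G, ⟨m, ⟨φ⟩⟩, ω, Γ, hΓ, hk⟩ := exists_kappa_eq_kappaFamily C
    (family := fun _ G => IsPathGraph G) (fun _ _ h => h.connected)
    (G₀ := SimpleGraph.pathGraph 2) ⟨0, ⟨SimpleGraph.Iso.refl⟩⟩
  -- Indices are ordered by position on the path, with ties broken arbitrarily. Ties with `i` are
  -- harmless, since those indices sit at the separator `ω i`.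
  obtain ⟨e, he⟩ := exists_equiv_fin_lt_iff
    (g := fun i : I => toLex (φ (ω i), Fintype.equivFin I i))
    (fun i j hij => (Fintype.equivFin I).injective (congrArg (fun t => (ofLex t).2) hij))
  refine finrank_mul_minDist_le C e _ fun i => ?_
  obtain ⟨i, rfl⟩ := e.surjective i
  have h := hΓ.finrank_le {ω i} {a | e a < e i} {a | e i < e a} (fun j hj => ?_)
    fun a ha b hb hab => ?_
  · rwa [Finset.card_singleton, one_mul, hk] at h
  · refine lt_or_gt_of_ne (a := e j) (b := e i) fun hji => hj ?_
    rw [e.injective hji, Finset.mem_singleton]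
  · have ha' := (he a i).1 ha
    have hb' := (he i b).1 hb
    rw [Prod.Lex.toLex_lt_toLex] at ha' hb'
    have hv : ω i ∈ (({ω i} : Finset V) : Set V) := by simp
    have hne : ∀ {x}, x ∉ (({ω i} : Finset V) : Set V) → φ x ≠ φ (ω i) := fun hx h =>
      hx (φ.injective h ▸ hv)
    have h1 : φ (ω a) < φ (ω i) := ha'.resolve_right fun h => hne hab.left h.1
    have h2 : φ (ω i) < φ (ω b) := hb'.resolve_right fun h => hne hab.right h.1.symm
    exact lt_asymm h2 (hab.lt_of_lt φ hv h1)

theorem codePathwidth_le_log_mul_codeTreewidth (C : Submodule F (I → F))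
    (hn : 1 < Fintype.card I) :
    codePathwidth C ≤ (Nat.log 2 (Fintype.card I) + 1) * codeTreewidth C := by
  obtain ⟨V, _, G, hG, ω, Γ, hΓ, hk⟩ := exists_kappa_eq_kappaFamily C
    (family := fun _ G => G.IsTree) (fun _ _ h => h.connected)
    (G₀ := (⊥ : SimpleGraph Unit)) SimpleGraph.IsTree.of_subsingleton
  -- This is the least `r` with `n < 2 ^ r`, so it bounds every component's weight when nothing has
  -- been removed.
  obtain ⟨e, he⟩ := hG.isAcyclic.exists_order ω (Nat.log 2 (Fintype.card I) + 1) ∅ fun x => by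
    refine lt_of_le_of_lt ?_ (Nat.lt_pow_succ_log_self Nat.one_lt_two (Fintype.card I))
    exact (Set.ncard_le_card _).trans_eq Nat.card_eq_fintype_card
  refine codePathwidth_le_of_equiv C hn e _ fun i => ?_
  obtain ⟨i, rfl⟩ := e.surjective i
  obtain ⟨W, hW, hiW, hsep⟩ := he i (Set.notMem_empty _)
  rw [Set.empty_union] at hsep
  refine (hΓ.finrank_le W {a | e a < e i} {a | e i < e a} (fun j hj => ?_)
    fun a ha b hb => hsep a b ha hb).trans ?_
  · refine lt_or_gt_of_ne (a := e j) (b := e i) fun hji => hj ?_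
    rwa [e.injective hji]
  · rw [codeTreewidth, ← hk]
    exact Nat.add_le_add_left (Nat.mul_le_mul_right _ hW) _

end Widths

/-- The last inequality is `n ≤ 2 * (n - 1)`. It turns the factor `log₂ n + 1` into at most `3 + 2 *
log₂ (n - 1)`, while `1 ≤ log₂ n` makes it at most `2 * log₂ n`, hence the constant `2` in (b). -/
theorem logb_nonneg_and_natLog_le {n : ℕ} (hn : 1 < n) :
    0 ≤ Real.logb 2 ((n : ℝ) - 1) ∧ (Nat.log 2 n : ℝ) ≤ Real.logb 2 n ∧
      1 ≤ Real.logb 2 n ∧ Real.logb 2 n ≤ 1 + Real.logb 2 ((n : ℝ) - 1) := by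
  have h2 : (2 : ℝ) ≤ n := by exact_mod_cast hn
  have h1 : Real.logb 2 2 = 1 := Real.logb_self_eq_one one_lt_two
  refine ⟨Real.logb_nonneg one_lt_two (by linarith), ?_, ?_, ?_⟩
  · exact_mod_cast Real.natLog_le_logb n 2
  · rw [← h1]
    exact Real.logb_le_logb_of_le one_lt_two (by norm_num) h2
  · rw [← h1, ← Real.logb_mul (by norm_num) (by linarith)]
    exact Real.logb_le_logb_of_le one_lt_two (by linarith) (by linarith)

theorem mainTheorem4 :
    (∀ (F : Type u) [Field F] [Finite F] (I : Type v) [Fintype I] (C : Submodule F (I → F))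
        (n k d : ℕ), IsLinearCodeWith C n k d → 1 < n →
      (codePathwidth C : ℝ) / (3 + 2 * Real.logb 2 ((n : ℝ) - 1)) ≤ (codeTreewidth C : ℝ) ∧
      (k : ℝ) * ((d : ℝ) - 1) / ((n : ℝ) * (3 + 2 * Real.logb 2 ((n : ℝ) - 1))) ≤
        (codePathwidth C : ℝ) / (3 + 2 * Real.logb 2 ((n : ℝ) - 1))) ∧
    (∃ c : ℝ, 0 < c ∧
      ∀ (F : Type u) [Field F] [Finite F] (I : Type v) [Fintype I] (C : Submodule F (I → F)),
        1 < Fintype.card I → C ≠ ⊥ →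
        0 < codeTreewidth C ∧
        (codePathwidth C : ℝ) / (codeTreewidth C : ℝ) ≤
          c * Real.logb 2 (Fintype.card I : ℝ)) := by
  refine ⟨?_, 2, two_pos, ?_⟩
  · rintro F _ _ I _ C n k d ⟨rfl, rfl, rfl⟩ hn
    obtain ⟨h1, h2, h3, h4⟩ := logb_nonneg_and_natLog_le hn
    have hpos : 0 < 3 + 2 * Real.logb 2 ((Fintype.card I : ℝ) - 1) := by linarith
    have hnpos : (0 : ℝ) < Fintype.card I := by exact_mod_cast zero_lt_one.trans hn
    constructor
    · rw [div_le_iff₀ hpos]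
      have h : (codePathwidth C : ℝ) ≤
          ((Nat.log 2 (Fintype.card I) : ℝ) + 1) * codeTreewidth C := by
        exact_mod_cast codePathwidth_le_log_mul_codeTreewidth C hn
      refine h.trans ?_
      rw [mul_comm]
      exact mul_le_mul_of_nonneg_left (by linarith) (Nat.cast_nonneg _)
    · rw [← div_div]
      refine div_le_div_of_nonneg_right ?_ hpos.le
      rw [div_le_iff₀ hnpos]
      have h : (Module.finrank F C : ℝ) * minDist C ≤ Fintype.card I * codePathwidth C := by
        exact_mod_cast finrank_mul_minDist_le_codePathwidth C
      have hk : (0 : ℝ) ≤ Module.finrank F C := Nat.cast_nonneg _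
      linarith
  · intro F _ _ I _ C hn hC
    obtain ⟨h1, h2, h3, h4⟩ := logb_nonneg_and_natLog_le hn
    have hle := codePathwidth_le_log_mul_codeTreewidth C hn
    have hpos : 0 < codeTreewidth C := by
      rw [Nat.pos_iff_ne_zero]
      intro h0
      have hk := finrank_mul_minDist_le_codePathwidth C
      rw [h0, mul_zero, Nat.le_zero] at hle
      rw [hle, mul_zero, Nat.le_zero] at hk
      have h5 : 0 < Module.finrank F C := by
        rwa [Nat.pos_iff_ne_zero, Ne, Submodule.finrank_eq_zero]
      exact (Nat.mul_pos h5 (minDist_pos hC)).ne' hk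
    refine ⟨hpos, ?_⟩
    rw [div_le_iff₀ (by exact_mod_cast hpos)]
    have h : (codePathwidth C : ℝ) ≤
        ((Nat.log 2 (Fintype.card I) : ℝ) + 1) * codeTreewidth C := by exact_mod_cast hle
    refine h.trans (mul_le_mul_of_nonneg_right (by linarith) (Nat.cast_nonneg _))
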